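/- Let $\mathfrak S_n$ be the set of permutations of $n$ letters. A permutation is *alternating* if it starts with a rise and then descents and rises come in turn ($\pi_1<\pi_2>\pi_3<\cdots$); the empty permutation and the permutation of one letter are alternating. It is *up-down* (*up-up*) if it is alternating, has length at least $2$, and ends with a descent (with a rise). Write $A_n(1\text{-}3\text{-}2)$, $UD_n(1\text{-}3\text{-}2)$ and $UU_n(1\text{-}3\text{-}2)$ for the sets of alternating, up-down and up-up permutations in $\mathfrak S_n$ that avoid the classical pattern $1\text{-}3\text{-}2$. For $j\ge 2$ let $12\text{-}3\text{-}\cdots\text{-}j(\pi)$ be the number of occurrences in $\pi$ of the generalized pattern $12\text{-}3\text{-}\cdots\text{-}j$, that is, of subsequences of $\pi$ order-isomorphic to $1\,2\,3\cdots j$ whose first two letters are adjacent in $\pi$; define $21\text{-}3\text{-}\cdots\text{-}j(\pi)$ likewise with $2\,1\,3\cdots j$. Let $K$ be a field, let $x_2,x_3,\dots$ be nonzero elements of $K$ (for example, independent indeterminates, with $K=\mathbb Q(x_2,x_3,\dots)$), and let $x_1$ be a further indeterminate. In $K[[x_1]]$ put $$UD_2(x_1,x_2,\dots)=\sum_{n\ge0}\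 \sum_{\pi\in UD_n(1\text{-}3\text{-}2)}x_1^{n}\prod_{j\ge2}x_j^{12\text{-}3\text{-}\cdots\text{-}j(\pi)},\qquad UU_2(x_1,x_2,\dots)=\sum_{n\ge0}\ \sum_{\pi\in UU_n(1\text{-}3\text{-}2)}x_1^{n}\prod_{j\ge2}x_j^{12\text{-}3\text{-}\cdots\text{-}j(\pi)},$$ and let $UD_3$, $UU_3$ be the same series with $21\text{-}3\text{-}\cdots\text{-}j(\pi)$ in place of $12\text{-}3\text{-}\cdots\text{-}j(\pi)$. For $d\ge0$ put $p_d=\prod_{j\ge2}x_j^{\binom{d}{j-2}}$. Then the following identities hold in the field $K((x_1))$. 1. $$UD_2(x_1,x_2,\dots)=\cfrac{-x_1^2p_0}{x_1p_0-\cfrac{1}{x_1-\cfrac{x_1^2p_1}{x_1p_1-\cfrac{1}{x_1-\cfrac{x_1^2p_2}{x_1p_2-\cfrac{1}{x_1-\ddots}}}}}},$$ meaning that all convergents of this infinite continued fraction (formed by the usual recurrences for numerators and denominators, with partial numerators $-x_1^2p_0,-1,-x_1^2p_1,-1,\dots$ and partial denominators $x_1p_0,x_1,x_1p_1,x_1,\dots$)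 have nonzero denominators, and they converge to $UD_2(x_1,x_2,\dots)$ in the $x_1$-adic topology. 2. $$UU_2(x_1,x_2,\dots)=\cfrac{-1}{1-\cfrac{1}{x_1^2x_2+x_1x_2\,UD_2(x_1,x_2x_3,x_3x_4,\dots)}},$$ where both denominators are nonzero. 3. $$\sum_{n\ge0}\ \sum_{\pi\in A_n(1\text{-}3\text{-}2)}x_1^{n}\prod_{j\ge2}x_j^{12\text{-}3\text{-}\cdots\text{-}j(\pi)}=1+x_1+(1+x_1)\,UU_2(x_1,x_2,\dots).$$ 4. $UD_3(x_1,x_2,\dots)=UD_2(x_1,x_2,\dots)$ and $UU_3(x_1,x_2,\dots)=\dfrac{1}{x_2}\,UU_2(x_1,x_2,\dots)$. 5. $$\sum_{n\ge0}\ \sum_{\pi\in A_n(1\text{-}3\text{-}2)}x_1^{n}\prod_{j\ge2}x_j^{21\text{-}3\text{-}\cdots\text{-}j(\pi)}=1+x_1+\Bigl(x_1+\frac1{x_2}\Bigr)UU_2(x_1,x_2,\dots).$$ -/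

import Mathlib

open Filter Topology

namespace AltPattern

/-! ### Alternating permutations

A permutation of `n` letters is an element of `Equiv.Perm (Fin n)`; positions and letters are
counted from `0`. -/

/-- `π` starts with a rise, and then descents and rises come in turn: the step from position `i`
to position `i + 1` (counted from `0`) is a rise exactly when `i` is even. The empty permutation
and the permutation of one letter are alternating. -/
def IsAlternating {n : ℕ} (π : Equiv.Perm (Fin n)) : Prop :=
  ∀ (i : ℕ) (h : i + 1 < n), π ⟨i, Nat.lt_of_succ_lt h⟩ < π ⟨i + 1, h⟩ ↔ Even i

/-- Up-down permutations: at least two letters, alternating, the last step is a descent. -/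
def IsUpDown {n : ℕ} (π : Equiv.Perm (Fin n)) : Prop :=
  IsAlternating π ∧ ∃ h : 2 ≤ n, π ⟨n - 1, by omega⟩ < π ⟨n - 2, by omega⟩

/-- Up-up permutations: at least two letters, alternating, the last step is a rise. -/
def IsUpUp {n : ℕ} (π : Equiv.Perm (Fin n)) : Prop :=
  IsAlternating π ∧ ∃ h : 2 ≤ n, π ⟨n - 2, by omega⟩ < π ⟨n - 1, by omega⟩

/-! ### Generalized patterns -/

/-- The word `p` (with distinct letters) together with the set `adj` is a generalized pattern:
`a ∈ adj` means that there is no dash between the letters at positions `a` and `a + 1` of `p`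
(counted from `0`). The subsequence of `π` at the positions `f 0 < f 1 < ⋯` is an occurrence of
the pattern if it is order-isomorphic to `p`, and letters that are not separated by a dash
are taken from adjacent positions of `π`. -/
def IsOccurrence {k n : ℕ} (p : Fin k → ℕ) (adj : Set ℕ) (π : Equiv.Perm (Fin n))
    (f : Fin k ↪o Fin n) : Prop :=
  (∀ a b : Fin k, π (f a) < π (f b) ↔ p a < p b) ∧
    ∀ (a : ℕ) (h : a + 1 < k), a ∈ adj →
      (f ⟨a + 1, h⟩ : ℕ) = (f ⟨a, Nat.lt_of_succ_lt h⟩ : ℕ) + 1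

/-- The number of occurrences of a generalized pattern in `π`. -/
noncomputable def occ {k n : ℕ} (p : Fin k → ℕ) (adj : Set ℕ) (π : Equiv.Perm (Fin n)) : ℕ :=
  Nat.card {f : Fin k ↪o Fin n // IsOccurrence p adj π f}

/-- A pattern with more letters than `π` does not occur in `π`. -/
theorem occ_eq_zero {k n : ℕ} (h : n < k) (p : Fin k → ℕ) (adj : Set ℕ)
    (π : Equiv.Perm (Fin n)) : occ p adj π = 0 := by
  have : IsEmpty (Fin k ↪o Fin n) :=
    ⟨fun f => by
      have := Fintype.card_le_of_injective f f.injective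
      simp only [Fintype.card_fin] at this
      omega⟩
  have : IsEmpty {f : Fin k ↪o Fin n // IsOccurrence p adj π f} := ⟨fun f => this.elim f.1⟩
  exact Nat.card_of_isEmpty

/-- `π` avoids the classical pattern `1-3-2`. -/
def Avoids132 {n : ℕ} (π : Equiv.Perm (Fin n)) : Prop :=
  ∀ f : Fin 3 ↪o Fin n, ¬ IsOccurrence ![1, 3, 2] ∅ π f

/-- The number of occurrences of `12-3-⋯-j`. -/
noncomputable def occ12 (j : ℕ) {n : ℕ} (π : Equiv.Perm (Fin n)) : ℕ :=
  occ (fun i : Fin j => (i : ℕ) + 1) {0} π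

/-- The number of occurrences of `21-3-⋯-j` (for `2 ≤ j`). -/
noncomputable def occ21 (j : ℕ) {n : ℕ} (π : Equiv.Perm (Fin n)) : ℕ :=
  occ (fun i : Fin j => if (i : ℕ) = 0 then 2 else if (i : ℕ) = 1 then 1 else (i : ℕ) + 1) {0} π

/-! ### Generating functions

The variable `x₁`, which marks the length, is the variable of the field of formal Laurent series
`LaurentSeries K`; the other arguments `x₂, x₃, …` are elements of the field of coefficients `K`,
given as a sequence `x : ℕ → K` (the values `x 0` and `x 1` are not used). With
`K = ℚ(x₂, x₃, …)` and `x j` the indeterminate `x_j` these are the generating functions in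
independent indeterminates `x₁, x₂, …`. -/

variable {K : Type*} [Field K]

/-- The variable `x₁`. -/
noncomputable def x₁ : LaurentSeries K := ((PowerSeries.X : PowerSeries K) : LaurentSeries K)

/-- An element of `K` as a constant Laurent series. -/
noncomputable def const (a : K) : LaurentSeries K := HahnSeries.C a

open scoped Classical in
/-- The generating function `∑ₙ ∑_π x₁ⁿ ∏_{j ≥ 2} x_j ^ stat j π`, where `π` runs over the
permutations of `n` letters that avoid `1-3-2` and satisfy `P`. It is used with `stat j π` the
number of occurrences in `π` of a pattern of `j` letters, which is `0` for `n < j`. -/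
noncomputable def genFun (P : ∀ n : ℕ, Equiv.Perm (Fin n) → Prop)
    (stat : ℕ → ∀ n : ℕ, Equiv.Perm (Fin n) → ℕ) (x : ℕ → K) : LaurentSeries K :=
  ((PowerSeries.mk fun n : ℕ =>
    ∑ π : Equiv.Perm (Fin n) with P n π ∧ Avoids132 π,
      ∏ j ∈ Finset.Icc 2 n, x j ^ stat j n π : PowerSeries K) : LaurentSeries K)

/-- `UD₂(x₁, x₂, …)`: up-down permutations, patterns `12-3-⋯-j`. -/
noncomputable def UD₂ (x : ℕ → K) : LaurentSeries K :=
  genFun (fun _ => IsUpDown) (fun j _ => occ12 j) x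

/-- `UU₂(x₁, x₂, …)`: up-up permutations, patterns `12-3-⋯-j`. -/
noncomputable def UU₂ (x : ℕ → K) : LaurentSeries K :=
  genFun (fun _ => IsUpUp) (fun j _ => occ12 j) x

/-- All alternating permutations, patterns `12-3-⋯-j`. -/
noncomputable def A₂ (x : ℕ → K) : LaurentSeries K :=
  genFun (fun _ => IsAlternating) (fun j _ => occ12 j) x

/-- `UD₃(x₁, x₂, …)`: up-down permutations, patterns `21-3-⋯-j`. -/
noncomputable def UD₃ (x : ℕ → K) : LaurentSeries K :=
  genFun (fun _ => IsUpDown) (fun j _ => occ21 j) x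

/-- `UU₃(x₁, x₂, …)`: up-up permutations, patterns `21-3-⋯-j`. -/
noncomputable def UU₃ (x : ℕ → K) : LaurentSeries K :=
  genFun (fun _ => IsUpUp) (fun j _ => occ21 j) x

/-- All alternating permutations, patterns `21-3-⋯-j`. -/
noncomputable def A₃ (x : ℕ → K) : LaurentSeries K :=
  genFun (fun _ => IsAlternating) (fun j _ => occ21 j) x

/-! ### The continued fraction -/

/-- `∏_{j ≥ 2} x_j ^ binom(d, j - 2)`; the factors with `j > d + 2` are `1`. -/
def binomProd (x : ℕ → K) (d : ℕ) : K :=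
  ∏ j ∈ Finset.Icc 2 (d + 2), x j ^ d.choose (j - 2)

/-- The infinite continued fraction with partial numerators `a₁, a₂, …` and partial denominators
`b₁, b₂, …`, namely `a₁ / (b₁ + a₂ / (b₂ + ⋯))`, where, with `p_d = binomProd x d`,
`a_{2d+1} = -x₁² p_d`, `b_{2d+1} = x₁ p_d`, `a_{2d+2} = -1`, `b_{2d+2} = x₁`. That is,
`-x₁² p₀ / (x₁ p₀ - 1 / (x₁ - x₁² p₁ / (x₁ p₁ - 1 / (x₁ - x₁² p₂ / (x₁ p₂ - ⋯)))))`. -/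
noncomputable def contFrac (x : ℕ → K) : GenContFract (LaurentSeries K) where
  h := 0
  s := Stream'.Seq.ofStream fun n : ℕ =>
    if Even n then
      ⟨-(x₁ ^ 2 * const (binomProd x (n / 2))), x₁ * const (binomProd x (n / 2))⟩
    else ⟨-1, x₁⟩

/-- The sequence of arguments `x₂ x₃, x₃ x₄, …` in place of `x₂, x₃, …`. -/
def shift (x : ℕ → K) : ℕ → K := fun j => x j * x (j + 1)

end AltPattern

/-! Cut a nonempty permutation avoiding `1-3-2` at its largest letter. Every letter on the left
exceeds every letter on the right, so the permutation is `(σ + b) (a + b) τ` with `σ`, `τ` avoiding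
`1-3-2`, of lengths `a` and `b`, and all such pairs occur (`isGlue_glue`, `exists_glue_eq`). If
there are at least two letters, it alternates exactly when `a` is odd and `σ`, `τ` alternate
(`IsGlue.alternating_iff`).

For `j ≥ 3` an occurrence of `12-3-⋯-j` or `21-3-⋯-j` lies in `σ`, lies in `τ`, or ends at the
largest letter and comes from an occurrence of the pattern with `j - 1` letters in `σ`. Hence `σ` is
weighted with `x_j x_{j+1}` in place of `x_j`, which is `shift`. For `j = 2` the largest letter adds
one occurrence if `a > 0` (for `12`) or if `b > 0` (for `21`).

Let `F` and `H` be the series of odd and even lengths for `12-3-⋯-j`, let `F'` be `F` at the shifted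
arguments, and put `c = x₂`, `z = x₁`. Then `F = z + z c F' F` and `H = 1 + z c F' H`, so `F = z H`.
For `21-3-⋯-j` the odd series satisfies the same equation, whose solution is unique, while the even
series satisfies `H' = 1 + z F' (1 + c (H' - 1))`, whence `c (H' - 1) = H - 1`. With `UD = F - z`
and `UU = H - 1` all closed formulas follow.

Iterating `F = z / (1 - z c F')` gives the continued fraction, since `d` shifts turn `x₂` into
`p_d`. The error of its convergents of even index is an explicit product
(`ContFrac.dens_mul_sub_nums`) divisible by growing powers of `z`, and each later convergent of odd
index repeats one of even index. -/

namespace AltPattern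

/-! ### Permutations as words on `ℕ` -/

/-- The word of a permutation, as a function on `ℕ` that vanishes beyond the length. -/
noncomputable def word {n : ℕ} (π : Equiv.Perm (Fin n)) (i : ℕ) : ℕ :=
  if h : i < n then (π ⟨i, h⟩ : ℕ) else 0

theorem word_of_lt {n : ℕ} (π : Equiv.Perm (Fin n)) {i : ℕ} (h : i < n) :
    word π i = (π ⟨i, h⟩ : ℕ) := dif_pos h

theorem word_coe {n : ℕ} (π : Equiv.Perm (Fin n)) (i : Fin n) :
    word π i = (π i : ℕ) := word_of_lt π i.2

theorem word_lt {n : ℕ} (π : Equiv.Perm (Fin n)) {i : ℕ} (h : i < n) : word π i < n := by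
  rw [word_of_lt π h]; exact (π _).2

theorem word_injOn {n : ℕ} (π : Equiv.Perm (Fin n)) {i j : ℕ} (hi : i < n) (hj : j < n)
    (h : word π i = word π j) : i = j := by
  rw [word_of_lt π hi, word_of_lt π hj] at h
  simpa using π.injective (Fin.ext h)

theorem word_injective {n : ℕ} {π ρ : Equiv.Perm (Fin n)}
    (h : ∀ i < n, word π i = word ρ i) : π = ρ := by
  ext i
  rw [← word_coe, ← word_coe, h i i.2]

theorem avoids132_iff {n : ℕ} (π : Equiv.Perm (Fin n)) :
    Avoids132 π ↔ ∀ i j k, i < j → j < k → k < n →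
      ¬ (word π i < word π k ∧ word π k < word π j) := by
  constructor
  · rintro h i j k hij hjk hk ⟨h1, h2⟩
    have hj : j < n := hjk.trans hk
    have hi : i < n := hij.trans hj
    rw [word_of_lt π hi, word_of_lt π hk] at h1
    rw [word_of_lt π hj, word_of_lt π hk] at h2
    have hm : StrictMono (![⟨i, hi⟩, ⟨j, hj⟩, ⟨k, hk⟩] : Fin 3 → Fin n) := by
      rw [Fin.strictMono_iff_lt_succ]
      intro m
      fin_cases m
      · simpa using hij
      · simpa using hjk
    refine h (OrderEmbedding.ofStrictMono _ hm) ⟨?_, by simp⟩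
    intro u v
    replace h1 : π ⟨i, hi⟩ < π ⟨k, hk⟩ := h1
    replace h2 : π ⟨k, hk⟩ < π ⟨j, hj⟩ := h2
    have h3 := h1.trans h2
    fin_cases u <;> fin_cases v <;> simp [h1, h2, h3, h1.le, h2.le, h3.le]
  · rintro h f ⟨hf, -⟩
    have m1 : f 0 < f 1 := f.strictMono (by decide)
    have m2 : f 1 < f 2 := f.strictMono (by decide)
    refine h (f 0) (f 1) (f 2) m1 m2 (f 2).2 ?_
    rw [word_coe, word_coe, word_coe]
    exact ⟨(hf 0 2).2 (by simp), (hf 2 1).2 (by simp)⟩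

theorem isAlternating_iff {n : ℕ} (π : Equiv.Perm (Fin n)) :
    IsAlternating π ↔ ∀ i, i + 1 < n → (word π i < word π (i + 1) ↔ Even i) := by
  refine forall_congr' fun i => forall_congr' fun h => ?_
  rw [word_of_lt π (Nat.lt_of_succ_lt h), word_of_lt π h, Fin.lt_def]

/-- The last step starts at position `n - 2`, so in an alternating permutation the parity of `n`
decides its direction. -/
theorem isUpDown_iff {n : ℕ} (π : Equiv.Perm (Fin n)) :
    IsUpDown π ↔ IsAlternating π ∧ 2 ≤ n ∧ Odd n := by
  refine and_congr_right fun h => ⟨?_, ?_⟩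
  · rintro ⟨h2, hlt⟩
    refine ⟨h2, ?_⟩
    by_contra hodd
    rw [Nat.not_odd_iff_even] at hodd
    have := (h (n - 2) (by omega)).2 (by grind)
    simp only [show n - 2 + 1 = n - 1 by omega] at this
    exact absurd this hlt.asymm
  · rintro ⟨h2, hodd⟩
    refine ⟨h2, ?_⟩
    have := mt (h (n - 2) (by omega)).1 (by grind)
    simp only [show n - 2 + 1 = n - 1 by omega] at this
    refine lt_of_le_of_ne (not_lt.1 this) fun he => ?_
    have := π.injective he
    simp only [Fin.mk.injEq] at this
    omega

theorem isUpUp_iff {n : ℕ} (π : Equiv.Perm (Fin n)) :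
    IsUpUp π ↔ IsAlternating π ∧ 2 ≤ n ∧ Even n := by
  refine and_congr_right fun h => ⟨fun ⟨h2, hlt⟩ => ⟨h2, ?_⟩, fun ⟨h2, he⟩ => ⟨h2, ?_⟩⟩ <;>
  have := h (n - 2) (by omega) <;>
  simp only [show n - 2 + 1 = n - 1 by omega] at this
  · rw [this] at hlt
    grind
  · rw [this]
    grind

/-! ### Decomposition at the largest letter -/

/-- The word `w` consists of the word `s` of `a` letters, raised by `b`, the largest letter
`a + b`, and the word `t` of `b` letters. -/
structure IsGlue (a b : ℕ) (w s t : ℕ → ℕ) : Prop where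
  left : ∀ i < a, w i = s i + b
  peak : w a = a + b
  right : ∀ i < b, w (a + 1 + i) = t i
  left_lt : ∀ i < a, s i < a
  right_lt : ∀ i < b, t i < b

namespace IsGlue

variable {a b : ℕ} {w s t : ℕ → ℕ}

theorem right' (h : IsGlue a b w s t) {i : ℕ} (hi : a < i) (hib : i < a + b + 1) :
    w i = t (i - (a + 1)) := by
  rw [← h.right _ (by omega), show a + 1 + (i - (a + 1)) = i by omega]

theorem lt_of_right (h : IsGlue a b w s t) {i : ℕ} (hi : a < i) (hib : i < a + b + 1) :
    w i < b := by
  rw [h.right' hi hib]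
  exact h.right_lt _ (by omega)

theorem lt_peak (h : IsGlue a b w s t) {i : ℕ} (hi : i ≠ a) (hib : i < a + b + 1) :
    w i < a + b := by
  rcases lt_or_gt_of_ne hi with hl | hg
  · have := h.left _ hl
    have := h.left_lt _ hl
    omega
  · have := h.lt_of_right hg hib
    omega

theorem lt_of_cross (h : IsGlue a b w s t) {i j : ℕ} (hi : i < a) (hj : a < j)
    (hjb : j < a + b + 1) : w j < w i := by
  have := h.left _ hi
  have := h.lt_of_right hj hjb
  omega

/-- The largest letter could only play the `3`. An occurrence with its `1` on the left and its `2`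
on the right is impossible, as left letters exceed right ones; so every occurrence stays on one
side. -/
theorem avoids_iff (h : IsGlue a b w s t) :
    (∀ i j k, i < j → j < k → k < a + b + 1 → ¬ (w i < w k ∧ w k < w j)) ↔
      (∀ i j k, i < j → j < k → k < a → ¬ (s i < s k ∧ s k < s j)) ∧
      (∀ i j k, i < j → j < k → k < b → ¬ (t i < t k ∧ t k < t j)) := by
  refine ⟨fun H => ⟨fun i j k hij hjk hk => ?_, fun i j k hij hjk hk => ?_⟩, ?_⟩
  · have := H i j k hij hjk (by omega)
    rw [h.left i (by omega), h.left j (by omega), h.left k hk] at this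
    omega
  · have := H (a + 1 + i) (a + 1 + j) (a + 1 + k) (by omega) (by omega) (by omega)
    rwa [h.right i (by omega), h.right j (by omega), h.right k hk] at this
  · rintro ⟨h1, h2⟩ i j k hij hjk hk ⟨hik, hkj⟩
    rcases lt_trichotomy k a with hka | rfl | hka
    · refine h1 i j k hij hjk hka ?_
      rw [h.left i (by omega), h.left j (by omega), h.left k hka] at *
      omega
    · have := h.lt_peak (i := j) (by omega) (by omega)
      rw [h.peak] at hkj
      omega
    · rcases lt_trichotomy i a with hia | rfl | hia
      · exact absurd (h.lt_of_cross hia hka hk) hik.asymm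
      · have := h.lt_peak (i := k) (by omega) (by omega)
        rw [h.peak] at hik
        omega
      · rw [h.right' hia (by omega), h.right' (i := j) (by omega) (by omega),
          h.right' hka hk] at *
        exact h2 _ _ _ (by omega) (by omega) (by omega) ⟨hik, hkj⟩

/-- The step into the largest letter is a rise, which forces `a` to be odd; then `t` starts at the
even position `a + 1` and parities are kept. A single letter is excluded because it alternates with
`a = 0`. -/
theorem alternating_iff (h : IsGlue a b w s t) (hab : 0 < a + b) :
    (∀ i, i + 1 < a + b + 1 → (w i < w (i + 1) ↔ Even i)) ↔
      Odd a ∧ (∀ i, i + 1 < a → (s i < s (i + 1) ↔ Even i)) ∧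
      (∀ i, i + 1 < b → (t i < t (i + 1) ↔ Even i)) := by
  constructor
  · intro H
    have ha : Odd a := by
      rcases Nat.eq_zero_or_pos a with rfl | ha
      · have := (H 0 (by omega)).2 (by simp)
        have h' := h.lt_peak (i := 1) (by omega) (by omega)
        rw [h.peak] at this
        exact absurd this h'.asymm
      · have h' := h.lt_peak (i := a - 1) (by omega) (by omega)
        rw [← h.peak] at h'
        have := (H (a - 1) (by omega)).1 (by rwa [Nat.sub_add_cancel ha])
        grind
    refine ⟨ha, fun i hi => ?_, fun i hi => ?_⟩
    · have := H i (by omega)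
      rwa [h.left i (by omega), h.left _ hi, Nat.add_lt_add_iff_right] at this
    · have := H (a + 1 + i) (by omega)
      rw [add_assoc (a + 1) i 1, h.right i (by omega), h.right _ hi] at this
      rw [this]
      grind
  · rintro ⟨ha, h1, h2⟩ i hi
    rcases lt_trichotomy (i + 1) a with hia | rfl | hia
    · rw [h.left i (by omega), h.left _ hia, Nat.add_lt_add_iff_right, h1 i hia]
    · have h' := h.lt_peak (i := i) (by omega) (by omega)
      rw [← h.peak] at h'
      simp only [h', true_iff]
      grind
    · rcases (show a = i ∨ a < i by omega) with rfl | hia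
      · have h' := h.lt_peak (i := a + 1) (by omega) (by omega)
        rw [← h.peak] at h'
        simp only [h'.asymm, false_iff]
        grind
      · rw [h.right' hia (by omega), h.right' (i := i + 1) (by omega) hi,
          show i + 1 - (a + 1) = i - (a + 1) + 1 by omega, h2 _ (by omega)]
        grind

end IsGlue

/-! ### Counting occurrences across the decomposition -/

/-- The occurrences of a generalized pattern in the first `n` letters of a word. -/
def occSet {k : ℕ} (n : ℕ) (w : ℕ → ℕ) (p : Fin k → ℕ) (adj : Set ℕ) : Set (Fin k → ℕ) :=
  {g | StrictMono g ∧ (∀ i, g i < n) ∧ (∀ u v, w (g u) < w (g v) ↔ p u < p v) ∧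
    ∀ (u : ℕ) (h : u + 1 < k), u ∈ adj → g ⟨u + 1, h⟩ = g ⟨u, Nat.lt_of_succ_lt h⟩ + 1}

theorem occSet_finite {k : ℕ} (n : ℕ) (w : ℕ → ℕ) (p : Fin k → ℕ) (adj : Set ℕ) :
    (occSet n w p adj).Finite :=
  (Set.Finite.pi' fun _ => Set.finite_Iio n).subset fun _ hg => hg.2.1

theorem occ_eq_ncard {k n : ℕ} (p : Fin k → ℕ) (adj : Set ℕ) (π : Equiv.Perm (Fin n)) :
    occ p adj π = (occSet n (word π) p adj).ncard := by
  refine Nat.card_eq_of_bijective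
    (fun f => (⟨fun i => (f.1 i : ℕ), fun _ _ h => f.1.strictMono h, fun i => (f.1 i).2,
      fun u v => ?_, f.2.2⟩ : occSet n (word π) p adj)) ⟨?_, ?_⟩
  · rw [word_coe, word_coe]
    exact f.2.1 u v
  · intro f g h
    ext i
    exact congrFun (congrArg Subtype.val h) i
  · rintro ⟨g, h1, h2, h3, h4⟩
    refine ⟨⟨OrderEmbedding.ofStrictMono (fun i => ⟨g i, h2 i⟩) fun _ _ h => h1 h, ?_, h4⟩, rfl⟩
    intro u v
    rw [← h3, word_of_lt π (h2 u), word_of_lt π (h2 v)]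
    rfl

namespace IsGlue

variable {a b : ℕ} {w s t : ℕ → ℕ}

/-- If an occurrence that avoids the largest letter lies on one side of it, the occurrences in
`w` are those in `s`, those in `t`, and those that use the largest letter. -/
theorem ncard_occSet (h : IsGlue a b w s t) {k : ℕ} (hk : 0 < k) (p : Fin k → ℕ) (adj : Set ℕ)
    (hcross : ∀ g ∈ occSet (a + b + 1) w p adj,
      (∀ i, g i < a) ∨ (∀ i, a < g i) ∨ ∃ i, g i = a) :
    (occSet (a + b + 1) w p adj).ncard = (occSet a s p adj).ncard + (occSet b t p adj).ncard +
      {g ∈ occSet (a + b + 1) w p adj | ∃ i, g i = a}.ncard := by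
  have hr : Function.Injective fun (g : Fin k → ℕ) i => a + 1 + g i := by
    intro f g hfg
    ext i
    simpa using congrFun hfg i
  have hs : ∀ g : Fin k → ℕ, (∀ i, g i < a) →
      (g ∈ occSet (a + b + 1) w p adj ↔ g ∈ occSet a s p adj) := by
    intro g hg
    have h1 : ∀ i, g i < a + b + 1 := fun i => (hg i).trans (by omega)
    simp only [occSet, Set.mem_ofPred_eq, hg, h1, h.left _ (hg _), implies_true,
      Nat.add_lt_add_iff_right]
  have ht : ∀ g : Fin k → ℕ, (∀ i, g i < b) →
      ((fun i => a + 1 + g i) ∈ occSet (a + b + 1) w p adj ↔ g ∈ occSet b t p adj) := by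
    intro g hg
    have h1 : ∀ i, a + 1 + g i < a + b + 1 := fun i => by have := hg i; omega
    simp only [occSet, Set.mem_ofPred_eq, hg, h1, h.right _ (hg _), implies_true, StrictMono,
      Nat.add_lt_add_iff_left, add_assoc (a + 1), Nat.add_left_cancel_iff]
  have hunion : occSet (a + b + 1) w p adj =
      occSet a s p adj ∪ (fun (g : Fin k → ℕ) i => a + 1 + g i) '' occSet b t p adj ∪
        {g ∈ occSet (a + b + 1) w p adj | ∃ i, g i = a} := by
    ext g
    constructor
    · intro hg
      rcases hcross g hg with h1 | h1 | h1
      · exact Or.inl (Or.inl ((hs g h1).1 hg))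
      · refine Or.inl (Or.inr ⟨fun i => g i - (a + 1), (ht _ fun i => ?_).1 ?_, ?_⟩)
        · have := hg.2.1 i
          have := h1 i
          omega
        · convert hg using 2 with i
          have := h1 i
          omega
        · ext i
          have := h1 i
          simp only
          omega
      · exact Or.inr ⟨hg, h1⟩
    · rintro ((hg | ⟨g, hg, rfl⟩) | hg)
      · exact (hs g hg.2.1).2 hg
      · exact (ht g hg.2.1).2 hg
      · exact hg.1
  conv_lhs => rw [hunion]
  have f1 := occSet_finite a s p adj
  have f2 := (occSet_finite b t p adj).image fun (g : Fin k → ℕ) i => a + 1 + g i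
  have f3 : {g ∈ occSet (a + b + 1) w p adj | ∃ i, g i = a}.Finite :=
    (occSet_finite (a + b + 1) w p adj).subset fun _ hg => hg.1
  rw [Set.ncard_union_eq _ (f1.union f2) f3, Set.ncard_union_eq _ f1 f2,
    Set.ncard_image_of_injective _ hr]
  · rw [Set.disjoint_left]
    rintro _ hg ⟨g, -, rfl⟩
    have := hg.2.1 ⟨0, hk⟩
    simp only at this
    omega
  · rw [Set.disjoint_left]
    rintro _ (hg | ⟨g, -, rfl⟩) ⟨-, i, hi⟩
    · exact (hg.2.1 i).ne hi
    · simp only at hi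
      omega

/-- If the last letter of the pattern is the largest one and is preceded by a dash, the occurrences
that use the largest letter of `w` are the occurrences in `s` of the pattern without its last
letter. -/
theorem ncard_occSet_peak (h : IsGlue a b w s t) {m : ℕ} (p : Fin (m + 1) → ℕ) (adj : Set ℕ)
    (hp : ∀ i : Fin m, p i.castSucc < p (Fin.last m)) (hadj : ∀ i ∈ adj, i + 1 < m) :
    {g ∈ occSet (a + b + 1) w p adj | ∃ i, g i = a}.ncard =
      (occSet a s (fun i : Fin m => p i.castSucc) adj).ncard := by
  have hinj : Function.Injective fun g : Fin m → ℕ => (Fin.snoc g a : Fin (m + 1) → ℕ) := by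
    intro f g hfg
    ext i
    simpa using congrFun hfg i.castSucc
  rw [← Set.ncard_image_of_injective _ hinj]
  congr 1
  ext g
  constructor
  · rintro ⟨⟨h1, h2, h3, h4⟩, i, hi⟩
    have hlast : g (Fin.last m) = a := by
      -- Otherwise the last chosen letter lies below the largest one, although another chosen letter
      -- is the largest and must be smaller than the last.
      by_contra hne
      have := h.lt_peak hne (h2 _)
      rw [← h.peak, ← hi, h3] at this
      induction i using Fin.lastCases with
      | last => exact hne hi
      | cast i => exact this.asymm (hp i)
    have hlt : ∀ i : Fin m, g i.castSucc < a := fun i => by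
      rw [← hlast]
      exact h1 (Fin.castSucc_lt_last i)
    refine ⟨fun i => g i.castSucc, ⟨fun u v huv => h1 (by simpa using huv), hlt, fun u v => ?_,
      fun u hu hua => h4 u (by omega) hua⟩, ?_⟩
    · rw [← h3, h.left _ (hlt u), h.left _ (hlt v), Nat.add_lt_add_iff_right]
    · ext i
      induction i using Fin.lastCases with
      | last => simp [hlast]
      | cast i => simp
  · rintro ⟨g, ⟨h1, h2, h3, h4⟩, rfl⟩
    refine ⟨⟨?_, ?_, ?_, ?_⟩, Fin.last m, by simp⟩
    · intro u v huv
      induction v using Fin.lastCases with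
      | last =>
        induction u using Fin.lastCases with
        | last => exact absurd huv (lt_irrefl _)
        | cast u => simpa using h2 u
      | cast v =>
        induction u using Fin.lastCases with
        | last => exact absurd huv (Fin.castSucc_lt_last v).asymm
        | cast u => simpa using h1 (by simpa using huv)
    · intro i
      induction i using Fin.lastCases with
      | last => simp only [Fin.snoc_last]; omega
      | cast i => simp only [Fin.snoc_castSucc]; have := h2 i; omega
    · intro u v
      have hl : ∀ i, w (g i) = s (g i) + b := fun i => h.left _ (h2 i)
      have hll : ∀ i, s (g i) < a := fun i => h.left_lt _ (h2 i)
      induction v using Fin.lastCases with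
      | last =>
        induction u using Fin.lastCases with
        | last => simp
        | cast u =>
          have := hll u
          simp only [Fin.snoc_last, Fin.snoc_castSucc, hl, h.peak, hp u, iff_true]
          omega
      | cast v =>
        induction u using Fin.lastCases with
        | last =>
          have := hll v
          simp only [Fin.snoc_last, Fin.snoc_castSucc, hl, h.peak, (hp v).asymm, iff_false]
          omega
        | cast u => simp only [Fin.snoc_castSucc, hl, ← h3, Nat.add_lt_add_iff_right]
    · intro u hu hua
      have hm := hadj u hua
      have := h4 u hm hua
      simpa [Fin.snoc, hm, (Nat.lt_of_succ_lt hm)] using this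

/-- An occurrence that starts with adjacent letters and that either has two letters or ends with
a letter larger than its first one does not pass over the largest letter. -/
theorem cross_of_lt (h : IsGlue a b w s t) {m : ℕ} (p : Fin (m + 2) → ℕ)
    (hp : p 0 < p (Fin.last (m + 1)) ∨ m = 0) (g : Fin (m + 2) → ℕ)
    (hg : g ∈ occSet (a + b + 1) w p {0}) :
    (∀ i, g i < a) ∨ (∀ i, a < g i) ∨ ∃ i, g i = a := by
  obtain ⟨h1, h2, h3, h4⟩ := hg
  rcases lt_trichotomy (g 0) a with h0 | h0 | h0
  · rcases lt_trichotomy (g (Fin.last _)) a with hl | hl | hl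
    · exact Or.inl fun i => (h1.monotone (Fin.le_last i)).trans_lt hl
    · exact Or.inr (Or.inr ⟨_, hl⟩)
    · rcases hp with hp | rfl
      · exact absurd ((h3 _ _).2 hp) (h.lt_of_cross h0 hl (h2 _)).asymm
      -- With only two letters, adjacency prevents jumping over position `a`.
      · have : g 1 = g 0 + 1 := h4 0 (by omega) rfl
        change a < g 1 at hl
        omega
  · exact Or.inr (Or.inr ⟨_, h0⟩)
  · exact Or.inr (Or.inl fun i => h0.trans_le (h1.monotone (Fin.zero_le i)))

end IsGlue

/-! ### The statistics `12-3-⋯-j` and `21-3-⋯-j` -/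

/-- A family of statistics on permutations, indexed by `j ≥ 2`, that behaves under glueing like the
numbers of occurrences of `12-3-⋯-j`; `e a b` is the number of occurrences of the pattern with
`j = 2` that use the largest letter. -/
structure IsGlueStat (stat : ℕ → ∀ n : ℕ, Equiv.Perm (Fin n) → ℕ) (e : ℕ → ℕ → ℕ) : Prop where
  eq_zero : ∀ {j n : ℕ} (π : Equiv.Perm (Fin n)), n < j → stat j n π = 0
  two : ∀ {n a b : ℕ} {π : Equiv.Perm (Fin (n + 1))} {σ : Equiv.Perm (Fin a)}
    {τ : Equiv.Perm (Fin b)}, a + b = n → IsGlue a b (word π) (word σ) (word τ) →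
    stat 2 (n + 1) π = stat 2 a σ + stat 2 b τ + e a b
  add_three : ∀ {n a b : ℕ} {π : Equiv.Perm (Fin (n + 1))} {σ : Equiv.Perm (Fin a)}
    {τ : Equiv.Perm (Fin b)} (m : ℕ), a + b = n → IsGlue a b (word π) (word σ) (word τ) →
    stat (m + 3) (n + 1) π = stat (m + 3) a σ + stat (m + 3) b τ + stat (m + 2) a σ

/-- The largest letter can only be the top of a rise, so for `j = 2` the one occurrence using it is
at positions `a - 1`, `a`, and it needs `a > 0`. -/
theorem isGlueStat_occ12 : IsGlueStat (fun j _ => occ12 j) fun a _ => if 0 < a then 1 else 0 where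
  eq_zero π h := occ_eq_zero h _ _ π
  two := by
    rintro n a b π σ τ rfl h
    simp only [occ12, occ_eq_ncard]
    rw [h.ncard_occSet (by norm_num) _ _ (h.cross_of_lt _ (Or.inr rfl))]
    congr 1
    split_ifs with ha
    · rw [Set.ncard_eq_one]
      refine ⟨![a - 1, a], ?_⟩
      ext g
      constructor
      · rintro ⟨⟨h1, h2, h3, h4⟩, i, hi⟩
        have h01 : g 1 = g 0 + 1 := h4 0 (by norm_num) rfl
        have hlt : word π (g 0) < word π (g 1) := (h3 0 1).2 (by simp)
        have hi1 : g 1 = a := by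
          by_contra hne
          have hp := h.lt_peak hne (h2 1)
          fin_cases i
          · simp only [Fin.zero_eta] at hi
            rw [hi, h.peak] at hlt
            omega
          · exact hne hi
        ext i
        fin_cases i
        · simp; omega
        · simpa using hi1
      · rintro rfl
        have hp := h.lt_peak (i := a - 1) (by omega) (by omega)
        replace hp := hp.trans_eq h.peak.symm
        refine ⟨⟨?_, ?_, ?_, ?_⟩, 1, rfl⟩
        · rw [Fin.strictMono_iff_lt_succ]
          intro m
          fin_cases m
          simp; omega
        · intro i
          fin_cases i <;> simp; omega
        · intro u v
          fin_cases u <;> fin_cases v <;> simp [hp, hp.le]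
        · rintro u hu rfl
          simp; omega
    · rw [Set.ncard_eq_zero ((occSet_finite _ _ _ _).subset fun _ hg => hg.1)]
      rw [Set.eq_empty_iff_forall_notMem]
      rintro g ⟨⟨h1, h2, h3, h4⟩, i, hi⟩
      have h01 : g 1 = g 0 + 1 := h4 0 (by norm_num) rfl
      have hlt : word π (g 0) < word π (g 1) := (h3 0 1).2 (by simp)
      have hi0 : g 0 = a := by
        fin_cases i
        · exact hi
        · simp only [Fin.mk_one] at hi
          omega
      have hp := h.lt_peak (i := g 1) (by omega) (h2 1)
      rw [hi0, h.peak] at hlt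
      omega
  add_three := by
    rintro n a b π σ τ m rfl h
    simp only [occ12, occ_eq_ncard]
    rw [h.ncard_occSet (by omega) _ _ (h.cross_of_lt _ (Or.inl (by simp))),
      h.ncard_occSet_peak _ _ (fun i => by simp; omega) (by simp)]
    rfl

/-- The largest letter can only be the top of a descent, so for `j = 2` the one occurrence using it
is at positions `a`, `a + 1`, and it needs `b > 0`. -/
theorem isGlueStat_occ21 : IsGlueStat (fun j _ => occ21 j) fun _ b => if 0 < b then 1 else 0 where
  eq_zero π h := occ_eq_zero h _ _ π
  two := by
    rintro n a b π σ τ rfl h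
    simp only [occ21, occ_eq_ncard]
    rw [h.ncard_occSet (by norm_num) _ _ (h.cross_of_lt _ (Or.inr rfl))]
    congr 1
    split_ifs with hb
    · rw [Set.ncard_eq_one]
      refine ⟨![a, a + 1], ?_⟩
      ext g
      constructor
      · rintro ⟨⟨h1, h2, h3, h4⟩, i, hi⟩
        have h01 : g 1 = g 0 + 1 := h4 0 (by norm_num) rfl
        have hlt : word π (g 1) < word π (g 0) := (h3 1 0).2 (by simp)
        have hi0 : g 0 = a := by
          by_contra hne
          have hp := h.lt_peak hne (h2 0)
          fin_cases i
          · exact hne hi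
          · simp only [Fin.mk_one] at hi
            rw [hi, h.peak] at hlt
            omega
        ext i
        fin_cases i
        · simpa using hi0
        · simp; omega
      · rintro rfl
        have hp := h.lt_peak (i := a + 1) (by omega) (by omega)
        replace hp := hp.trans_eq h.peak.symm
        refine ⟨⟨?_, ?_, ?_, ?_⟩, 0, rfl⟩
        · rw [Fin.strictMono_iff_lt_succ]
          intro m
          fin_cases m
          simp
        · intro i
          fin_cases i <;> simp; omega
        · intro u v
          fin_cases u <;> fin_cases v <;> simp [hp, hp.le]
        · rintro u hu rfl
          simp
    · rw [Set.ncard_eq_zero ((occSet_finite _ _ _ _).subset fun _ hg => hg.1)]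
      rw [Set.eq_empty_iff_forall_notMem]
      rintro g ⟨⟨h1, h2, h3, h4⟩, i, hi⟩
      have h01 : g 1 = g 0 + 1 := h4 0 (by norm_num) rfl
      have hlt : word π (g 1) < word π (g 0) := (h3 1 0).2 (by simp)
      have hl := h2 1
      have hi1 : g 1 = a := by
        fin_cases i
        · simp only [Fin.zero_eta] at hi
          omega
        · exact hi
      have hp := h.lt_peak (i := g 0) (by omega) (h2 0)
      rw [hi1, h.peak] at hlt
      omega
  add_three := by
    rintro n a b π σ τ m rfl h
    simp only [occ21, occ_eq_ncard]
    rw [h.ncard_occSet (by omega) _ _ (h.cross_of_lt _ (Or.inl (by simp))),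
      h.ncard_occSet_peak _ _ ?_ (by simp)]
    · rfl
    · intro i
      simp only [Fin.val_castSucc, Fin.val_last]
      split_ifs <;> first | contradiction | omega

/-! ### Glueing as a bijection onto the permutations that avoid `1-3-2` -/

/-- The word of the permutation `(σ + b) (a + b) τ`. -/
noncomputable def glueWord {a b : ℕ} (σ : Equiv.Perm (Fin a)) (τ : Equiv.Perm (Fin b)) (i : ℕ) :
    ℕ :=
  if i < a then word σ i + b else if i = a then a + b else word τ (i - (a + 1))

theorem isGlue_glueWord {a b : ℕ} (σ : Equiv.Perm (Fin a)) (τ : Equiv.Perm (Fin b)) :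
    IsGlue a b (glueWord σ τ) (word σ) (word τ) where
  left i hi := if_pos hi
  peak := by simp [glueWord]
  right i hi := by
    rw [glueWord, if_neg (by omega), if_neg (by omega)]
    congr 1
    omega
  left_lt i hi := word_lt σ hi
  right_lt i hi := word_lt τ hi

theorem glueWord_lt {a b : ℕ} (σ : Equiv.Perm (Fin a)) (τ : Equiv.Perm (Fin b)) {i : ℕ}
    (hi : i < a + b + 1) : glueWord σ τ i < a + b + 1 := by
  by_cases h : i = a
  · rw [h, (isGlue_glueWord σ τ).peak]
    omega
  · have := (isGlue_glueWord σ τ).lt_peak h hi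
    omega

theorem glueWord_injOn {a b : ℕ} (σ : Equiv.Perm (Fin a)) (τ : Equiv.Perm (Fin b)) {i j : ℕ}
    (hi : i < a + b + 1) (hj : j < a + b + 1) (hij : glueWord σ τ i = glueWord σ τ j) :
    i = j := by
  have h := isGlue_glueWord σ τ
  rcases lt_trichotomy i a with hia | rfl | hia
  · rcases lt_trichotomy j a with hja | rfl | hja
    · rw [h.left i hia, h.left j hja, Nat.add_right_cancel_iff] at hij
      exact word_injOn σ hia hja hij
    · have := h.lt_peak hia.ne hi
      rw [hij, h.peak] at this
      omega
    · exact absurd hij (h.lt_of_cross hia hja hj).ne'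
  · by_contra hne
    have := h.lt_peak (Ne.symm hne) hj
    rw [← hij, h.peak] at this
    omega
  · rcases lt_trichotomy j a with hja | rfl | hja
    · exact absurd hij (h.lt_of_cross hja hia hi).ne
    · have := h.lt_peak hia.ne' hi
      rw [hij, h.peak] at this
      omega
    · rw [h.right' hia hi, h.right' hja hj] at hij
      have := word_injOn τ (by omega) (by omega) hij
      omega

/-- The permutation `(σ + b) n τ` of `n + 1` letters, where `σ` has `a` and `τ` has `b = n - a`
letters. -/
noncomputable def glue {n : ℕ}
    (q : Σ a : Fin (n + 1), Equiv.Perm (Fin a) × Equiv.Perm (Fin (n - a))) :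
    Equiv.Perm (Fin (n + 1)) :=
  have hn : (q.1 : ℕ) + (n - q.1) = n := by omega
  Equiv.ofBijective
    (fun i => ⟨glueWord q.2.1 q.2.2 i, by
      have := glueWord_lt q.2.1 q.2.2 (i := i) (by omega)
      omega⟩)
    (Finite.injective_iff_bijective.1 fun i j hij =>
      Fin.ext (glueWord_injOn q.2.1 q.2.2 (by omega) (by omega) (Fin.mk.inj_iff.1 hij)))

theorem isGlue_glue {n : ℕ}
    (q : Σ a : Fin (n + 1), Equiv.Perm (Fin a) × Equiv.Perm (Fin (n - a))) :
    IsGlue q.1 (n - q.1) (word (glue q)) (word q.2.1) (word q.2.2) := by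
  have hw : ∀ i < n + 1, word (glue q) i = glueWord q.2.1 q.2.2 i := fun i hi => word_of_lt _ hi
  have h := isGlue_glueWord q.2.1 q.2.2
  refine ⟨fun i hi => ?_, ?_, fun i hi => ?_, h.left_lt, h.right_lt⟩
  · rw [hw i (by omega), h.left i hi]
  · rw [hw _ q.1.2, h.peak]
  · rw [hw _ (by omega), h.right i hi]

theorem glue_injective {n : ℕ} : Function.Injective (glue (n := n)) := by
  rintro ⟨a, σ, τ⟩ ⟨a', σ', τ'⟩ heq
  have h := isGlue_glue ⟨a, σ, τ⟩
  have h' := isGlue_glue ⟨a', σ', τ'⟩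
  rw [← heq] at h'
  obtain rfl : a = a' := by
    have h1 := h.peak
    have h2 := h'.peak
    simp only at h1 h2
    exact Fin.ext (word_injOn _ a.2 a'.2 (by rw [h1, h2]; omega))
  obtain rfl : σ = σ' := word_injective fun i hi => by
    have := h'.left i hi
    rw [h.left i hi] at this
    exact Nat.add_right_cancel this
  obtain rfl : τ = τ' := word_injective fun i hi => by
    have := h'.right i hi
    rwa [h.right i hi] at this
  rfl

theorem exists_glue_eq {n : ℕ} (π : Equiv.Perm (Fin (n + 1))) (hπ : Avoids132 π) :
    ∃ q, glue q = π := by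
  rw [avoids132_iff] at hπ
  obtain ⟨a, ha⟩ := π.surjective (Fin.last n)
  have hpeak : word π a = n := by rw [word_coe, ha]; rfl
  have hlt : ∀ i < n + 1, i ≠ a → word π i < n := by
    intro i hi hne
    refine lt_of_le_of_ne (Nat.le_of_lt_succ (word_lt π hi)) fun h => hne ?_
    exact word_injOn π hi a.2 (h.trans hpeak.symm)
  -- Otherwise the positions `i`, `a`, `j` form a `1-3-2`.
  have hcross : ∀ i < (a : ℕ), ∀ j, (a : ℕ) < j → j < n + 1 → word π j < word π i := by
    intro i hi j hj hjn
    have h1 := hπ i a j hi hj hjn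
    have h2 := hlt j hjn hj.ne'
    rw [hpeak] at h1
    refine lt_of_le_of_ne (by omega) fun h => ?_
    have := word_injOn π hjn (by omega) h
    omega
  have hright : ∀ j, (a : ℕ) < j → j < n + 1 → word π j < n - a := by
    intro j hj hjn
    -- The `a + 1` letters up to the peak are distinct and all exceed the letter at `j`.
    have hle : (Finset.range (a + 1)).card ≤ (Finset.Ioo (word π j) (n + 1)).card := by
      refine Finset.card_le_card_of_injOn (word π) (fun i hi => ?_) fun i hi i' hi' => ?_
      · simp only [Finset.coe_range, Set.mem_Iio] at hi
        simp only [Finset.coe_Ioo, Set.mem_Ioo]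
        refine ⟨?_, word_lt π (by omega)⟩
        rcases (show i < a ∨ i = a by omega) with h | rfl
        · exact hcross i h j hj hjn
        · rw [hpeak]
          exact hlt j hjn hj.ne'
      · simp only [Finset.coe_range, Set.mem_Iio] at hi hi'
        exact word_injOn π (by omega) (by omega)
    simp only [Finset.card_range, Nat.card_Ioo] at hle
    omega
  have hleft : ∀ i < (a : ℕ), n - a ≤ word π i := by
    intro i hi
    -- The `n - a` letters after the peak are distinct and all lie below the letter at `i`.
    have hle : (Finset.Ioo (a : ℕ) (n + 1)).card ≤ (Finset.range (word π i)).card := by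
      refine Finset.card_le_card_of_injOn (word π) (fun j hj => ?_) fun j hj j' hj' => ?_
      · simp only [Finset.coe_Ioo, Set.mem_Ioo] at hj
        simp only [Finset.coe_range, Set.mem_Iio]
        exact hcross i hi j hj.1 hj.2
      · simp only [Finset.coe_Ioo, Set.mem_Ioo] at hj hj'
        exact word_injOn π hj.2 hj'.2
    simp only [Finset.card_range, Nat.card_Ioo] at hle
    omega
  let σ : Equiv.Perm (Fin a) := Equiv.ofBijective
    (fun i => ⟨word π i - (n - a), by
      have := hlt i (by omega) (by omega)
      have := hleft i i.2
      omega⟩)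
    (Finite.injective_iff_bijective.1 fun i j hij => by
      have h1 := hleft i i.2
      have h2 := hleft j j.2
      have h3 := Fin.mk.inj_iff.1 hij
      exact Fin.ext (word_injOn π (by omega) (by omega) (by omega)))
  let τ : Equiv.Perm (Fin (n - a)) := Equiv.ofBijective
    (fun i => ⟨word π (a + 1 + i), hright _ (by omega) (by omega)⟩)
    (Finite.injective_iff_bijective.1 fun i j hij => by
      have := word_injOn π (by omega) (by omega) (Fin.mk.inj_iff.1 hij)
      exact Fin.ext (by omega))
  refine ⟨⟨a, σ, τ⟩, word_injective fun i hi => ?_⟩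
  have h := isGlue_glue ⟨a, σ, τ⟩
  rcases lt_trichotomy i a with hia | rfl | hia
  · have hσ : word σ i = word π i - (n - a) := word_of_lt σ hia
    rw [h.left i hia, hσ]
    exact Nat.sub_add_cancel (hleft i hia)
  · have := h.peak
    simp only at this
    rw [this, hpeak]
    omega
  · have hτ : word τ (i - (a + 1)) = word π (a + 1 + (i - (a + 1))) := word_of_lt τ (by omega)
    rw [h.right' hia (by simp only; omega), hτ]
    congr 1
    omega

/-! ### Weights and their recurrence -/

variable {K : Type*} [Field K]

theorem isAlternating_of_le_one {n : ℕ} (hn : n ≤ 1) (π : Equiv.Perm (Fin n)) :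
    IsAlternating π := fun i h => by omega

theorem avoids132_of_le_one {n : ℕ} (hn : n ≤ 1) (π : Equiv.Perm (Fin n)) : Avoids132 π := by
  rw [avoids132_iff]
  intro i j k _ _ _
  omega

open scoped Classical in
/-- The weight of an alternating permutation that avoids `1-3-2`, and `0` for other
permutations. -/
noncomputable def altWeight (stat : ℕ → ∀ n : ℕ, Equiv.Perm (Fin n) → ℕ) (x : ℕ → K) (n : ℕ)
    (π : Equiv.Perm (Fin n)) : K :=
  if IsAlternating π ∧ Avoids132 π then ∏ j ∈ Finset.Icc 2 n, x j ^ stat j n π else 0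

/-- The total weight of the alternating permutations of `n` letters that avoid `1-3-2`. -/
noncomputable def altSum (stat : ℕ → ∀ n : ℕ, Equiv.Perm (Fin n) → ℕ) (x : ℕ → K) (n : ℕ) : K :=
  ∑ π, altWeight stat x n π

theorem altSum_of_le_one (stat : ℕ → ∀ n : ℕ, Equiv.Perm (Fin n) → ℕ) (x : ℕ → K) {n : ℕ}
    (hn : n ≤ 1) : altSum stat x n = 1 := by
  have : ∀ π : Equiv.Perm (Fin n), altWeight stat x n π = 1 := fun π => by
    rw [altWeight, if_pos ⟨isAlternating_of_le_one hn π, avoids132_of_le_one hn π⟩,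
      Finset.Icc_eq_empty (by omega), Finset.prod_empty]
  simp only [altSum, this]
  interval_cases n <;> simp

namespace IsGlueStat

variable {stat : ℕ → ∀ n : ℕ, Equiv.Perm (Fin n) → ℕ} {e : ℕ → ℕ → ℕ}

theorem prod_Icc (hs : IsGlueStat stat e) (x : ℕ → K) {n N : ℕ} (hN : n ≤ N)
    (π : Equiv.Perm (Fin n)) :
    ∏ j ∈ Finset.Icc 2 N, x j ^ stat j n π = ∏ j ∈ Finset.Icc 2 n, x j ^ stat j n π := by
  refine (Finset.prod_subset (Finset.Icc_subset_Icc_right hN) fun j hj hj' => ?_).symm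
  rw [Finset.mem_Icc] at hj hj'
  rw [hs.eq_zero π (by omega), pow_zero]

/-- Each occurrence of the `j`-letter pattern in `σ` counts for `x j` and, extended by the largest
letter, for `x (j + 1)`; together this is `shift x j`. -/
theorem prod_glue (hs : IsGlueStat stat e) (x : ℕ → K) {n a b : ℕ} (hn : 0 < n)
    {π : Equiv.Perm (Fin (n + 1))} {σ : Equiv.Perm (Fin a)} {τ : Equiv.Perm (Fin b)}
    (hab : a + b = n) (h : IsGlue a b (word π) (word σ) (word τ)) :
    ∏ j ∈ Finset.Icc 2 (n + 1), x j ^ stat j (n + 1) π =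
      x 2 ^ e a b * (∏ j ∈ Finset.Icc 2 a, shift x j ^ stat j a σ) *
        ∏ j ∈ Finset.Icc 2 b, x j ^ stat j b τ := by
  obtain ⟨m, rfl⟩ : ∃ m, n = m + 1 := ⟨n - 1, by omega⟩
  -- All products are padded by trivial factors to comparable ranges. The one in `x (j + 1)` stops
  -- one index earlier, so that its largest variable is again `x (n + 1)`.
  rw [← hs.prod_Icc x (show b ≤ m + 1 + 1 by omega) τ]
  simp only [shift, mul_pow, Finset.prod_mul_distrib]
  rw [← hs.prod_Icc x (show a ≤ m + 1 + 1 by omega) σ,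
    ← hs.prod_Icc (fun j => x (j + 1)) (show a ≤ m + 1 by omega) σ]
  have hI : ∀ f : ℕ → K, ∏ j ∈ Finset.Icc 2 (m + 1 + 1), f j =
      f 2 * ∏ j ∈ Finset.range m, f (j + 3) := fun f => by
    rw [← Finset.Ico_add_one_right_eq_Icc, Finset.prod_Ico_eq_prod_range,
      show m + 1 + 1 + 1 - 2 = m + 1 by omega, Finset.prod_range_succ', mul_comm]
    congr 1
    exact Finset.prod_congr rfl fun j _ => by congr 1; omega
  have hI' : ∀ f : ℕ → K, ∏ j ∈ Finset.Icc 2 (m + 1), f j =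
      ∏ j ∈ Finset.range m, f (j + 2) := fun f => by
    rw [← Finset.Ico_add_one_right_eq_Icc, Finset.prod_Ico_eq_prod_range,
      show m + 1 + 1 - 2 = m by omega]
    exact Finset.prod_congr rfl fun j _ => by congr 1; omega
  simp only [hI, hI', hs.two hab h, hs.add_three _ hab h, pow_add, Finset.prod_mul_distrib]
  ring

theorem altWeight_glue (hs : IsGlueStat stat e) (x : ℕ → K) {n a b : ℕ} (hn : 0 < n)
    {π : Equiv.Perm (Fin (n + 1))} {σ : Equiv.Perm (Fin a)} {τ : Equiv.Perm (Fin b)}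
    (hab : a + b = n) (h : IsGlue a b (word π) (word σ) (word τ)) :
    altWeight stat x (n + 1) π = (if Odd a then x 2 ^ e a b else 0) *
      altWeight stat (shift x) a σ * altWeight stat x b τ := by
  have key : (IsAlternating π ∧ Avoids132 π) ↔
      Odd a ∧ (IsAlternating σ ∧ Avoids132 σ) ∧ IsAlternating τ ∧ Avoids132 τ := by
    subst hab
    rw [isAlternating_iff, isAlternating_iff, isAlternating_iff, avoids132_iff, avoids132_iff,
      avoids132_iff, h.alternating_iff hn, h.avoids_iff,
      and_assoc, and_and_and_comm]
  unfold altWeight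
  rw [hs.prod_glue x hn hab h]
  by_cases ha : Odd a
  · by_cases hσ : IsAlternating σ ∧ Avoids132 σ
    · by_cases hτ : IsAlternating τ ∧ Avoids132 τ
      · rw [if_pos (key.2 ⟨ha, hσ, hτ⟩), if_pos ha, if_pos hσ, if_pos hτ]
      · rw [if_neg fun hk => hτ (key.1 hk).2.2, if_neg hτ, mul_zero]
    · rw [if_neg fun hk => hσ (key.1 hk).2.1, if_neg hσ, mul_zero, zero_mul]
  · rw [if_neg fun hk => ha (key.1 hk).1, if_neg ha, zero_mul, zero_mul]

theorem altSum_succ (hs : IsGlueStat stat e) (x : ℕ → K) {n : ℕ} (hn : 0 < n) :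
    altSum stat x (n + 1) = ∑ q ∈ Finset.HasAntidiagonal.antidiagonal n,
      (if Odd q.1 then x 2 ^ e q.1 q.2 else 0) * altSum stat (shift x) q.1 *
        altSum stat x q.2 := by
  rw [Finset.Nat.sum_antidiagonal_eq_sum_range_succ_mk, Finset.sum_range, altSum,
    ← Fintype.sum_of_injective glue glue_injective _ _ ?_ fun q =>
      (hs.altWeight_glue x hn (by omega) (isGlue_glue q)).symm, Fintype.sum_sigma]
  · refine Finset.sum_congr rfl fun a _ => ?_
    simp only [Fintype.sum_prod_type, altSum, mul_assoc, Finset.mul_sum, Finset.sum_mul]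
    rw [Finset.sum_comm]
  -- Permutations outside the image of `glue` contain `1-3-2` and have weight `0`.
  · intro π hπ
    refine if_neg fun h => hπ ?_
    exact exists_glue_eq π h.2

end IsGlueStat

/-! ### Generating functions by parity and their functional equations -/

/-- The generating function of the alternating permutations of odd length. -/
noncomputable def oddSeries (stat : ℕ → ∀ n : ℕ, Equiv.Perm (Fin n) → ℕ) (x : ℕ → K) :
    PowerSeries K :=
  PowerSeries.mk fun n => if Odd n then altSum stat x n else 0

/-- The generating function of the alternating permutations of even length. -/
noncomputable def evenSeries (stat : ℕ → ∀ n : ℕ, Equiv.Perm (Fin n) → ℕ) (x : ℕ → K) :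
    PowerSeries K :=
  PowerSeries.mk fun n => if Even n then altSum stat x n else 0

-- The term `X` removes the one-letter permutation, which is alternating of odd length but too short
-- to be up-down.
open scoped Classical in
open PowerSeries in
theorem genFun_isUpDown (stat : ℕ → ∀ n : ℕ, Equiv.Perm (Fin n) → ℕ) (x : ℕ → K) :
    genFun (fun _ => IsUpDown) stat x = ((oddSeries stat x - X : PowerSeries K) :
      LaurentSeries K) := by
  unfold genFun
  congr 1
  ext n
  simp only [oddSeries, coeff_mk, map_sub, coeff_X, Finset.sum_filter]
  by_cases h : 2 ≤ n ∧ Odd n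
  · rw [if_pos h.2, if_neg (by omega), sub_zero]
    exact Finset.sum_congr rfl fun π _ =>
      if_congr (and_congr_left' ((isUpDown_iff π).trans (and_iff_left h))) rfl rfl
  · have h0 : ∀ π : Equiv.Perm (Fin n), ¬ (IsUpDown π ∧ Avoids132 π) := fun π hπ =>
      h ((isUpDown_iff π).1 hπ.1).2
    simp only [h0, if_false, Finset.sum_const_zero]
    rcases Nat.lt_or_ge 1 n with h1 | h1
    · rw [if_neg (by tauto), if_neg (by omega), sub_zero]
    · rw [altSum_of_le_one stat x h1]
      interval_cases n <;> simp

open scoped Classical in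
open PowerSeries in
theorem genFun_isUpUp (stat : ℕ → ∀ n : ℕ, Equiv.Perm (Fin n) → ℕ) (x : ℕ → K) :
    genFun (fun _ => IsUpUp) stat x = ((evenSeries stat x - 1 : PowerSeries K) :
      LaurentSeries K) := by
  unfold genFun
  congr 1
  ext n
  simp only [evenSeries, coeff_mk, map_sub, coeff_one, Finset.sum_filter]
  by_cases h : 2 ≤ n ∧ Even n
  · rw [if_pos h.2, if_neg (by omega), sub_zero]
    exact Finset.sum_congr rfl fun π _ =>
      if_congr (and_congr_left' ((isUpUp_iff π).trans (and_iff_left h))) rfl rfl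
  · have h0 : ∀ π : Equiv.Perm (Fin n), ¬ (IsUpUp π ∧ Avoids132 π) := fun π hπ =>
      h ((isUpUp_iff π).1 hπ.1).2
    simp only [h0, if_false, Finset.sum_const_zero]
    rcases Nat.lt_or_ge 1 n with h1 | h1
    · rw [if_neg (by tauto), if_neg (by omega), sub_zero]
    · rw [altSum_of_le_one stat x h1]
      interval_cases n <;> simp

open PowerSeries in
theorem genFun_isAlternating (stat : ℕ → ∀ n : ℕ, Equiv.Perm (Fin n) → ℕ) (x : ℕ → K) :
    genFun (fun _ => IsAlternating) stat x = ((oddSeries stat x + evenSeries stat x :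
      PowerSeries K) : LaurentSeries K) := by
  unfold genFun
  congr 1
  ext n
  simp only [oddSeries, evenSeries, coeff_mk, map_add]
  by_cases h : Even n
  · simp [h, Finset.sum_filter, altSum, altWeight, Nat.not_odd_iff_even.2 h]
  · simp [h, Finset.sum_filter, altSum, altWeight, Nat.not_even_iff_odd.1 h]

namespace IsGlueStat

variable {stat : ℕ → ∀ n : ℕ, Equiv.Perm (Fin n) → ℕ} {e : ℕ → ℕ → ℕ}

open PowerSeries

/-- If the total length and `a` are odd, so is `b`; both sides of the largest letter are then
nonempty, and this is why the two patterns share one equation. -/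
theorem oddSeries_eq (hs : IsGlueStat stat e) (he : ∀ a b, Odd a → Odd b → e a b = 1)
    (x : ℕ → K) :
    oddSeries stat x = X + X * (C (x 2) * oddSeries stat (shift x) * oddSeries stat x) := by
  ext n
  rcases n with _ | _ | n
  · simp [oddSeries]
  · simp [oddSeries, coeff_succ_X_mul, altSum_of_le_one]
  · rw [map_add, coeff_succ_X_mul, mul_assoc, coeff_C_mul, coeff_X, if_neg (by omega), zero_add,
      coeff_mul, Finset.mul_sum]
    simp only [oddSeries, coeff_mk]
    rw [hs.altSum_succ x (Nat.succ_pos n)]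
    split_ifs with h
    · refine Finset.sum_congr rfl fun q hq => ?_
      rw [Finset.HasAntidiagonal.mem_antidiagonal] at hq
      by_cases h1 : Odd q.1
      · have h2 : Odd q.2 := by grind
        rw [if_pos h1, if_pos h1, if_pos h2, he _ _ h1 h2]
        ring
      · simp [h1]
    · refine (Finset.sum_eq_zero fun q hq => ?_).symm
      rw [Finset.HasAntidiagonal.mem_antidiagonal] at hq
      by_cases h1 : Odd q.1
      · have h2 : ¬ Odd q.2 := by grind
        simp [h2]
      · simp [h1]

/-- The part of the recurrence for even lengths that does not depend on the statistic. -/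
theorem evenSeries_eq (hs : IsGlueStat stat e) (x : ℕ → K) (f : ℕ → K)
    (hf : ∀ a b, Odd a → x 2 ^ e a b = f b) :
    evenSeries stat x = 1 + X * (oddSeries stat (shift x) *
      PowerSeries.mk fun n => if Even n then f n * altSum stat x n else 0) := by
  ext n
  rcases n with _ | _ | n
  · simp [evenSeries, altSum_of_le_one]
  · simp [evenSeries, oddSeries, coeff_succ_X_mul, coeff_one]
  · rw [map_add, coeff_succ_X_mul, coeff_one, if_neg (by omega), zero_add, coeff_mul]
    simp only [evenSeries, oddSeries, coeff_mk]
    rw [hs.altSum_succ x (Nat.succ_pos n)]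
    split_ifs with h
    · refine Finset.sum_congr rfl fun q hq => ?_
      rw [Finset.HasAntidiagonal.mem_antidiagonal] at hq
      by_cases h1 : Odd q.1
      · have h2 : Even q.2 := by grind
        rw [if_pos h1, if_pos h1, if_pos h2, hf _ _ h1]
        ring
      · simp [h1]
    · refine (Finset.sum_eq_zero fun q hq => ?_).symm
      rw [Finset.HasAntidiagonal.mem_antidiagonal] at hq
      by_cases h1 : Odd q.1
      · have h2 : ¬ Even q.2 := by grind
        simp [h2]
      · simp [h1]

end IsGlueStat

open PowerSeries

theorem oddSeries_occ12 (x : ℕ → K) :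
    oddSeries (fun j _ => occ12 j) x = X + X * (C (x 2) *
      oddSeries (fun j _ => occ12 j) (shift x) * oddSeries (fun j _ => occ12 j) x) :=
  isGlueStat_occ12.oddSeries_eq (fun _ _ ha _ => if_pos ha.pos) x

theorem oddSeries_occ21 (x : ℕ → K) :
    oddSeries (fun j _ => occ21 j) x = X + X * (C (x 2) *
      oddSeries (fun j _ => occ21 j) (shift x) * oddSeries (fun j _ => occ21 j) x) :=
  isGlueStat_occ21.oddSeries_eq (fun _ _ _ hb => if_pos hb.pos) x

theorem evenSeries_occ12 (x : ℕ → K) :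
    evenSeries (fun j _ => occ12 j) x = 1 + X * (C (x 2) *
      oddSeries (fun j _ => occ12 j) (shift x) * evenSeries (fun j _ => occ12 j) x) := by
  conv_lhs => rw [isGlueStat_occ12.evenSeries_eq x (fun _ => x 2)
    fun a _ ha => by rw [if_pos ha.pos, pow_one]]
  rw [mul_comm (C (x 2)), mul_assoc]
  congr 3
  ext n
  simp [evenSeries]

theorem evenSeries_occ21 (x : ℕ → K) :
    evenSeries (fun j _ => occ21 j) x = 1 + X * (oddSeries (fun j _ => occ21 j) (shift x) *
      (1 + C (x 2) * (evenSeries (fun j _ => occ21 j) x - 1))) := by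
  -- For even length `τ` may be empty; then the largest letter comes last and starts no descent, so
  -- the constant term carries no factor `x 2`.
  conv_lhs => rw [isGlueStat_occ21.evenSeries_eq x (fun b => if 0 < b then x 2 else 1)
    fun a b _ => by split_ifs <;> simp]
  congr 3
  ext n
  rcases n with _ | n
  · simp [evenSeries, altSum_of_le_one]
  · simp [evenSeries, coeff_one]

/-- The solution of the functional equation of the odd series is unique. -/
theorem eq_of_functional_eq {F G : (ℕ → K) → PowerSeries K}
    (hF : ∀ x, F x = X + X * (C (x 2) * F (shift x) * F x))
    (hG : ∀ x, G x = X + X * (C (x 2) * G (shift x) * G x)) (x : ℕ → K) : F x = G x := by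
  -- The claim is made for all `x` at once, since the equation relates `x` to `shift x`; each use of
  -- it gains one factor `X`.
  have key : ∀ n x, (X : PowerSeries K) ^ n ∣ F x - G x := by
    intro n
    induction n with
    | zero => simp
    | succ n ih =>
      intro x
      have h : F x - G x = X * (C (x 2) * ((F (shift x) - G (shift x)) * F x +
          G (shift x) * (F x - G x))) := by
        linear_combination hF x - hG x
      rw [h, pow_succ']
      exact mul_dvd_mul_left _ (Dvd.dvd.mul_left (dvd_add (Dvd.dvd.mul_right (ih _) _)
        (Dvd.dvd.mul_left (ih _) _)) _)
  rw [← sub_eq_zero]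
  ext n
  exact X_pow_dvd_iff.1 (key (n + 1) x) n n.lt_succ_self

theorem oddSeries_occ21_eq (x : ℕ → K) :
    oddSeries (fun j _ => occ21 j) x = oddSeries (fun j _ => occ12 j) x :=
  eq_of_functional_eq oddSeries_occ21 oddSeries_occ12 x

/-! ### Iterated shifts and the products `p_d` -/

theorem iterate_shift_apply (d : ℕ) (x : ℕ → K) (j : ℕ) :
    shift^[d] x j = ∏ i ∈ Finset.range (d + 1), x (j + i) ^ d.choose i := by
  induction d generalizing x with
  | zero => simp
  | succ d ih =>
    -- One of the two products into which Pascal's rule splits the exponents, reindexed; its top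
    -- factor has exponent `d.choose (d + 1) = 0`.
    have h : (∏ i ∈ Finset.range (d + 1), x (j + i + 1) ^ d.choose (i + 1)) * x j =
        ∏ i ∈ Finset.range (d + 1), x (j + i) ^ d.choose i := by
      have := Finset.prod_range_succ' (fun i => x (j + i) ^ d.choose i) (d + 1)
      simp only [Nat.choose_zero_right, add_zero, pow_one] at this
      rw [Finset.prod_range_succ, Nat.choose_eq_zero_of_lt d.lt_succ_self, pow_zero, mul_one] at this
      exact this.symm
    rw [Function.iterate_succ_apply, ih, Finset.prod_range_succ' _ (d + 1)]
    simp only [shift, mul_pow, Finset.prod_mul_distrib, Nat.choose_succ_succ, pow_add,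
      Nat.choose_zero_right, add_zero, pow_one, ← add_assoc]
    rw [← h]
    ring

theorem iterate_shift_two (d : ℕ) (x : ℕ → K) : shift^[d] x 2 = binomProd x d := by
  rw [iterate_shift_apply, binomProd, ← Finset.Ico_add_one_right_eq_Icc,
    Finset.prod_Ico_eq_prod_range]
  exact Finset.prod_congr (by congr 1) fun i _ => by rw [Nat.add_sub_cancel_left]

theorem binomProd_ne_zero {x : ℕ → K} (hx : ∀ j, 2 ≤ j → x j ≠ 0) (d : ℕ) :
    binomProd x d ≠ 0 :=
  Finset.prod_ne_zero_iff.2 fun j hj => pow_ne_zero _ (hx j (Finset.mem_Icc.1 hj).1)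

/-! ### Convergence in the `x₁`-adic topology -/

/-- A sequence of Laurent series that agree with `f` up to higher and higher powers of the variable
converges to `f`. -/
theorem tendsto_of_sub_eq {u : ℕ → LaurentSeries K} {f : LaurentSeries K} {m : ℕ → ℕ}
    (hm : Tendsto m atTop atTop)
    (h : ∀ᶠ n in atTop, ∃ g : PowerSeries K,
      u n - f = ((PowerSeries.X ^ m n * g : PowerSeries K) : LaurentSeries K)) :
    Tendsto u atTop (𝓝 f) := by
  intro s hs
  obtain ⟨γ, hγ⟩ := Valued.mem_nhds.1 hs
  set δ := MonoidWithZeroHom.ValueGroup₀.embedding γ.1 with hδ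
  have hδ0 : δ ≠ 0 := by simp [hδ]
  change ∀ᶠ n in atTop, u n ∈ s
  -- Divisibility by `X ^ m n` bounds the valuation by `exp (-m n)`, which is below the radius `δ`
  -- once `m n > -log δ`.
  filter_upwards [h, hm.eventually_gt_atTop (-WithZero.log δ).toNat] with n ⟨g, hg⟩ hn
  refine hγ ?_
  change Valued.v.restrict (u n - f) < γ.1
  rw [Valuation.restrict_lt_iff_lt_embedding]
  refine lt_of_le_of_lt ((LaurentSeries.valuation_le_iff_coeff_lt_eq_zero K
    (D := (m n : ℤ))).2 fun i hi => ?_) ?_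
  · rw [hg, PowerSeries.coeff_coe]
    split_ifs with h0
    · rfl
    · exact PowerSeries.X_pow_dvd_iff.1 (dvd_mul_right _ g) _ (by omega)
  · rw [← hδ, ← WithZero.exp_log hδ0, WithZero.exp_lt_exp]
    omega

/-! ### Convergents of the continued fraction -/

namespace ContFrac

variable (x : ℕ → K)

theorem get_even (d : ℕ) : (contFrac x).s.get? (2 * d) =
    some ⟨-(x₁ ^ 2 * const (binomProd x d)), x₁ * const (binomProd x d)⟩ := by
  change some (if Even (2 * d) then _ else _) = _
  rw [if_pos (even_two_mul d), Nat.mul_div_cancel_left d two_pos]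

theorem get_odd (d : ℕ) : (contFrac x).s.get? (2 * d + 1) = some ⟨-1, x₁⟩ := by
  change some (if Even (2 * d + 1) then _ else _) = _
  rw [if_neg (by simp)]

theorem dens_one : (contFrac x).dens 1 = x₁ * const (binomProd x 0) :=
  GenContFract.first_den_eq (get_even x 0)

theorem nums_one : (contFrac x).nums 1 = -(x₁ ^ 2 * const (binomProd x 0)) := by
  rw [GenContFract.first_num_eq (get_even x 0), contFrac, mul_zero, zero_add]

theorem dens_even (d : ℕ) : (contFrac x).dens (2 * d + 2) =
    x₁ * (contFrac x).dens (2 * d + 1) - (contFrac x).dens (2 * d) := by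
  rw [GenContFract.dens_recurrence (get_odd x d) rfl rfl]
  ring

theorem nums_even (d : ℕ) : (contFrac x).nums (2 * d + 2) =
    x₁ * (contFrac x).nums (2 * d + 1) - (contFrac x).nums (2 * d) := by
  rw [GenContFract.nums_recurrence (get_odd x d) rfl rfl]
  ring

/-- Inserting `dens_even` cancels the contribution of index `2 * d + 1`. As `nums_odd` has the same
factor, the convergent of index `2 * d + 3` equals that of index `2 * d`. -/
theorem dens_odd (d : ℕ) : (contFrac x).dens (2 * d + 3) =
    -(x₁ * const (binomProd x (d + 1)) * (contFrac x).dens (2 * d)) := by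
  have h : (contFrac x).s.get? (2 * d + 1 + 1) =
      some ⟨-(x₁ ^ 2 * const (binomProd x (d + 1))), x₁ * const (binomProd x (d + 1))⟩ :=
    get_even x (d + 1)
  rw [show 2 * d + 3 = 2 * d + 1 + 2 from rfl, GenContFract.dens_recurrence h rfl rfl, dens_even]
  ring

theorem nums_odd (d : ℕ) : (contFrac x).nums (2 * d + 3) =
    -(x₁ * const (binomProd x (d + 1)) * (contFrac x).nums (2 * d)) := by
  have h : (contFrac x).s.get? (2 * d + 1 + 1) =
      some ⟨-(x₁ ^ 2 * const (binomProd x (d + 1))), x₁ * const (binomProd x (d + 1))⟩ :=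
    get_even x (d + 1)
  rw [show 2 * d + 3 = 2 * d + 1 + 2 from rfl, GenContFract.nums_recurrence h rfl rfl, nums_even]
  ring

open PowerSeries

theorem coe_C_eq_const (a : K) : ((C a : PowerSeries K) : LaurentSeries K) = const a :=
  HahnSeries.ofPowerSeries_C a

/-- The denominators with even index are power series with nonzero constant coefficient. -/
theorem exists_dens_even (d : ℕ) : ∃ B : PowerSeries K,
    (contFrac x).dens (2 * d) = (B : LaurentSeries K) ∧ constantCoeff B ≠ 0 := by
  -- The recurrence among even indices has two terms, so two neighbours are carried along; modulo
  -- `X` it only changes the sign.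
  suffices h : (∃ B : PowerSeries K, (contFrac x).dens (2 * d) = (B : LaurentSeries K) ∧
      constantCoeff B ≠ 0) ∧ ∃ B : PowerSeries K,
      (contFrac x).dens (2 * (d + 1)) = (B : LaurentSeries K) ∧ constantCoeff B ≠ 0 from h.1
  induction d with
  | zero =>
    refine ⟨⟨1, by simp, by simp⟩, X * (X * C (binomProd x 0)) - 1, ?_, by simp⟩
    have := dens_even x 0
    rw [mul_zero, zero_add, zero_add, dens_one, GenContFract.zeroth_den_eq_one] at this
    rw [show 2 * (0 + 1) = 2 from rfl, this, PowerSeries.coe_sub, PowerSeries.coe_mul,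
      PowerSeries.coe_mul, PowerSeries.coe_one, coe_C_eq_const]
    rfl
  | succ d ih =>
    obtain ⟨⟨B, hB, hB0⟩, B', hB', hB0'⟩ := ih
    refine ⟨⟨B', hB', hB0'⟩, X * (-(X * C (binomProd x (d + 1)) * B)) - B', ?_, by simpa using hB0'⟩
    rw [show 2 * (d + 1 + 1) = 2 * (d + 1) + 2 by ring, dens_even, hB',
      show 2 * (d + 1) + 1 = 2 * d + 3 by ring, dens_odd, hB]
    simp only [PowerSeries.coe_sub, PowerSeries.coe_mul, PowerSeries.coe_neg, coe_C_eq_const]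
    rfl

theorem x₁_ne_zero : (x₁ : LaurentSeries K) ≠ 0 := by
  rw [x₁, ← PowerSeries.coe_zero]
  exact fun h => PowerSeries.X_ne_zero (HahnSeries.ofPowerSeries_injective h)

theorem const_ne_zero {a : K} (ha : a ≠ 0) : const a ≠ 0 :=
  (map_ne_zero HahnSeries.C).2 ha

variable {x}

theorem dens_even_ne_zero (d : ℕ) : (contFrac x).dens (2 * d) ≠ 0 := by
  obtain ⟨B, hB, hB0⟩ := exists_dens_even x d
  rw [hB, ← PowerSeries.coe_zero]
  intro h
  rw [HahnSeries.ofPowerSeries_injective h] at hB0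
  exact hB0 (map_zero _)

theorem dens_ne_zero (hx : ∀ j, 2 ≤ j → x j ≠ 0) (n : ℕ) : (contFrac x).dens n ≠ 0 := by
  obtain ⟨d, rfl | rfl⟩ := n.even_or_odd'
  · exact dens_even_ne_zero d
  · rcases d with _ | d
    · rw [mul_zero, zero_add, dens_one]
      exact mul_ne_zero x₁_ne_zero (const_ne_zero (binomProd_ne_zero hx 0))
    · rw [show 2 * (d + 1) + 1 = 2 * d + 3 by ring, dens_odd]
      exact neg_ne_zero.2 (mul_ne_zero (mul_ne_zero x₁_ne_zero
        (const_ne_zero (binomProd_ne_zero hx _))) (dens_even_ne_zero d))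

/-- The error `B f - A` of a convergent `A / B` of even index, when `f + x₁ = F 0` for a
solution `F` of the functional equation. -/
theorem dens_mul_sub_nums {F : ℕ → PowerSeries K}
    (hF : ∀ d, F d = X + X * (C (binomProd x d) * F (d + 1) * F d)) (d : ℕ) :
    (contFrac x).dens (2 * d) * ((F 0 - X : PowerSeries K) : LaurentSeries K) -
      (contFrac x).nums (2 * d) =
    (((F d - X) * ∏ i ∈ Finset.range d, -(X * C (binomProd x i) * F i) : PowerSeries K) :
      LaurentSeries K) := by
  have hF' : ∀ d, (F d : LaurentSeries K) = x₁ + x₁ * (const (binomProd x d) *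
      (F (d + 1) : LaurentSeries K) * (F d : LaurentSeries K)) := fun d => by
    conv_lhs => rw [hF d]
    simp only [PowerSeries.coe_add, PowerSeries.coe_mul, coe_C_eq_const]
    rfl
  have hX : ((X : PowerSeries K) : LaurentSeries K) = x₁ := rfl
  induction d using Nat.twoStepInduction with
  | zero => simp [contFrac]
  | one =>
    have h1 := dens_even x 0
    have h2 := nums_even x 0
    rw [mul_zero, zero_add, zero_add, dens_one, GenContFract.zeroth_den_eq_one] at h1
    rw [mul_zero, zero_add, zero_add, nums_one, GenContFract.zeroth_num_eq_h] at h2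
    rw [mul_one, h1, h2, Finset.prod_range_one]
    simp only [PowerSeries.coe_sub, PowerSeries.coe_mul, PowerSeries.coe_neg, coe_C_eq_const, hX,
      contFrac]
    linear_combination -hF' 0
  | more d ih ih' =>
    have h1 := dens_even x (d + 1)
    have h2 := nums_even x (d + 1)
    rw [show 2 * (d + 1) + 1 = 2 * d + 3 by ring, dens_odd] at h1
    rw [show 2 * (d + 1) + 1 = 2 * d + 3 by ring, nums_odd] at h2
    rw [show 2 * (d + 2) = 2 * (d + 1) + 2 by ring, h1, h2, Finset.prod_range_succ,
      Finset.prod_range_succ]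
    rw [Finset.prod_range_succ] at ih'
    generalize ∏ i ∈ Finset.range d, -(X * C (binomProd x i) * F i) = P at *
    simp only [PowerSeries.coe_sub, PowerSeries.coe_mul, PowerSeries.coe_neg, coe_C_eq_const,
      hX] at *
    generalize (P : LaurentSeries K) = P at *
    have e0 := hF' d
    have e1 := hF' (d + 1)
    -- The errors `E_d` obey `E_{d+2} = -x₁² p_{d+1} E_d - E_{d+1}`; the functional equations of `F
    -- d` and `F (d + 1)` turn the right side into the product.
    linear_combination (-(x₁ ^ 2 * const (binomProd x (d + 1)))) * ih - ih' -
      x₁ ^ 2 * const (binomProd x (d + 1)) * P * e0 +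
      P * x₁ * const (binomProd x d) * (F d : LaurentSeries K) * e1

theorem tendsto_convs (hx : ∀ j, 2 ≤ j → x j ≠ 0) {F : ℕ → PowerSeries K}
    (hF : ∀ d, F d = X + X * (C (binomProd x d) * F (d + 1) * F d)) :
    Tendsto (fun n => (contFrac x).convs n) atTop
      (𝓝 ((F 0 - X : PowerSeries K) : LaurentSeries K)) := by
  have key : ∀ d, ∃ g : PowerSeries K, (contFrac x).nums (2 * d) / (contFrac x).dens (2 * d) -
      ((F 0 - X : PowerSeries K) : LaurentSeries K) =
        ((X ^ d * g : PowerSeries K) : LaurentSeries K) := by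
    intro d
    obtain ⟨B, hB, hB0⟩ := exists_dens_even x d
    have hdvd : (X : PowerSeries K) ^ d ∣
        ∏ i ∈ Finset.range d, -(X * C (binomProd x i) * F i) := by
      refine (Eq.dvd ?_).trans (Finset.prod_dvd_prod_of_dvd (fun _ => X) _ fun i _ =>
        (((dvd_mul_right X _).mul_right _).neg_right))
      simp
    obtain ⟨g, hg⟩ := hdvd
    refine ⟨-((F d - X) * g * B⁻¹), ?_⟩
    have herr := dens_mul_sub_nums hF d
    have hinv : (B : LaurentSeries K) * ((B⁻¹ : PowerSeries K) : LaurentSeries K) = 1 := by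
      rw [← PowerSeries.coe_mul, PowerSeries.mul_inv_cancel B hB0, PowerSeries.coe_one]
    have h0 := dens_even_ne_zero (x := x) d
    rw [div_sub' h0, div_eq_iff h0]
    rw [hg] at herr
    rw [hB] at herr ⊢
    simp only [PowerSeries.coe_sub, PowerSeries.coe_mul, PowerSeries.coe_neg] at *
    linear_combination (-1 : LaurentSeries K) * herr +
      ((F d : LaurentSeries K) - (X : PowerSeries K)) *
        (((X : PowerSeries K) ^ d : PowerSeries K) : LaurentSeries K) * g * hinv
  -- The exponent is set by the odd indices: `n = 2 * d + 3` has the accuracy `X ^ d` of index `2 *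
  -- d`. Even indices have factors `X` to spare.
  refine tendsto_of_sub_eq (m := fun n => (n - 3) / 2)
    ((Nat.tendsto_div_const_atTop two_ne_zero).comp (tendsto_sub_atTop_nat 3)) ?_
  filter_upwards [eventually_ge_atTop 3] with n hn
  rw [GenContFract.conv_eq_num_div_den]
  obtain ⟨d, rfl | rfl⟩ := n.even_or_odd'
  · obtain ⟨g, hg⟩ := key d
    obtain ⟨e, rfl⟩ : ∃ e, d = e + 2 := ⟨d - 2, by omega⟩
    refine ⟨X ^ 2 * g, ?_⟩
    rw [hg, show (2 * (e + 2) - 3) / 2 = e by omega, ← mul_assoc, pow_add]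
  · obtain ⟨d, rfl⟩ : ∃ e, d = e + 1 := ⟨d - 1, by omega⟩
    obtain ⟨g, hg⟩ := key d
    refine ⟨g, ?_⟩
    rw [show (2 * (d + 1) + 1 - 3) / 2 = d by omega, ← hg,
      show 2 * (d + 1) + 1 = 2 * d + 3 by ring, dens_odd, nums_odd, neg_div_neg_eq,
      mul_div_mul_left _ _ (mul_ne_zero x₁_ne_zero (const_ne_zero (binomProd_ne_zero hx _)))]

end ContFrac

end AltPattern

/-- The sequence of convergents is taken in the `x₁`-adic topology of `LaurentSeries K`; that the
denominators `dens n` and those in the formula for `UU₂` do not vanish makes all the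
quotients genuine. -/
theorem theorem6p2 {K : Type*} [Field K] (x : ℕ → K) (hx : ∀ j, 2 ≤ j → x j ≠ 0) :
    -- the continued fraction for `UD₂`
    ((∀ n, (AltPattern.contFrac x).dens n ≠ 0) ∧
      Tendsto (fun n : ℕ => (AltPattern.contFrac x).convs n) atTop (𝓝 (AltPattern.UD₂ x))) ∧
    -- the formula for `UU₂`
    (AltPattern.x₁ ^ 2 * AltPattern.const (x 2) + AltPattern.x₁ * AltPattern.const (x 2) *
          AltPattern.UD₂ (AltPattern.shift x) ≠ 0 ∧
      1 - 1 / (AltPattern.x₁ ^ 2 * AltPattern.const (x 2) +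
          AltPattern.x₁ * AltPattern.const (x 2) * AltPattern.UD₂ (AltPattern.shift x)) ≠ 0 ∧
      AltPattern.UU₂ x =
        -1 / (1 - 1 / (AltPattern.x₁ ^ 2 * AltPattern.const (x 2) +
          AltPattern.x₁ * AltPattern.const (x 2) * AltPattern.UD₂ (AltPattern.shift x)))) ∧
    -- all alternating permutations, patterns `12-3-⋯-j`
    AltPattern.A₂ x =
      1 + AltPattern.x₁ + (1 + AltPattern.x₁) * AltPattern.UU₂ x ∧
    -- the patterns `21-3-⋯-j`
    AltPattern.UD₃ x = AltPattern.UD₂ x ∧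
    AltPattern.UU₃ x = 1 / AltPattern.const (x 2) * AltPattern.UU₂ x ∧
    -- all alternating permutations, patterns `21-3-⋯-j`
    AltPattern.A₃ x =
      1 + AltPattern.x₁ + (AltPattern.x₁ + 1 / AltPattern.const (x 2)) * AltPattern.UU₂ x := by
  have hc := AltPattern.ContFrac.const_ne_zero (hx 2 le_rfl)
  have hx₁ := AltPattern.ContFrac.x₁_ne_zero (K := K)
  have hcoe (a : K) :
      ((PowerSeries.C a : PowerSeries K) : LaurentSeries K) = AltPattern.const a :=
    AltPattern.ContFrac.coe_C_eq_const a
  have hX : ((PowerSeries.X : PowerSeries K) : LaurentSeries K) = AltPattern.x₁ := rfl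
  have hF (y : ℕ → K) := congrArg (fun f : PowerSeries K => (f : LaurentSeries K))
    (AltPattern.oddSeries_occ12 y)
  have hH := congrArg (fun f : PowerSeries K => (f : LaurentSeries K))
    (AltPattern.evenSeries_occ12 x)
  have hH' := congrArg (fun f : PowerSeries K => (f : LaurentSeries K))
    (AltPattern.evenSeries_occ21 x)
  have hUD := AltPattern.genFun_isUpDown (fun j _ => AltPattern.occ12 j) (K := K)
  have hUU := AltPattern.genFun_isUpUp (fun j _ => AltPattern.occ12 j) x
  have hA := AltPattern.genFun_isAlternating (fun j _ => AltPattern.occ12 j) x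
  have hUD' := AltPattern.genFun_isUpDown (fun j _ => AltPattern.occ21 j) x
  have hUU' := AltPattern.genFun_isUpUp (fun j _ => AltPattern.occ21 j) x
  have hA' := AltPattern.genFun_isAlternating (fun j _ => AltPattern.occ21 j) x
  rw [AltPattern.oddSeries_occ21_eq] at hH' hUD' hA'
  refine ⟨⟨AltPattern.ContFrac.dens_ne_zero hx, ?_⟩, ?_⟩
  · rw [AltPattern.UD₂, hUD]
    refine AltPattern.ContFrac.tendsto_convs hx
      (F := fun d => AltPattern.oddSeries (fun j _ => AltPattern.occ12 j)
        (AltPattern.shift^[d] x)) fun d => ?_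
    rw [← AltPattern.iterate_shift_two, Function.iterate_succ_apply']
    exact AltPattern.oddSeries_occ12 _
  have hFx := hF x
  have hFs := hF (AltPattern.shift x)
  rw [AltPattern.UD₂, AltPattern.UU₂, AltPattern.A₂, AltPattern.UD₃, AltPattern.UU₃,
    AltPattern.A₃, AltPattern.UD₂, hUD, hUD, hUU, hA, hUD', hUU', hA']
  simp only [PowerSeries.coe_add, PowerSeries.coe_sub, PowerSeries.coe_mul, PowerSeries.coe_one,
    hcoe, hX] at hFx hFs hH hH' ⊢
  set F : LaurentSeries K :=
    (AltPattern.oddSeries (fun j _ => AltPattern.occ12 j) x : LaurentSeries K)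
  set F' : LaurentSeries K :=
    (AltPattern.oddSeries (fun j _ => AltPattern.occ12 j) (AltPattern.shift x) : LaurentSeries K)
  set H : LaurentSeries K :=
    (AltPattern.evenSeries (fun j _ => AltPattern.occ12 j) x : LaurentSeries K)
  set H' : LaurentSeries K :=
    (AltPattern.evenSeries (fun j _ => AltPattern.occ21 j) x : LaurentSeries K)
  set c : LaurentSeries K := AltPattern.const (x 2)
  set z : LaurentSeries K := AltPattern.x₁
  -- The summand `z ^ 2 * c` restores the one-letter permutation missing from `UD₂`.
  have hG : z ^ 2 * c + z * c * (F' - z) = z * c * F' := by ring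
  have hF'0 : F' ≠ 0 := fun h => hx₁ (by simpa [h] using hFs.symm)
  have hG0 : z * c * F' ≠ 0 := mul_ne_zero (mul_ne_zero hx₁ hc) hF'0
  -- The even equation says `(1 - z c F') H = 1`.
  have hG1 : 1 - z * c * F' ≠ 0 := fun h =>
    one_ne_zero (α := LaurentSeries K) (by linear_combination -hH + H * h)
  have hden : 1 - 1 / (z * c * F') ≠ 0 := by
    rw [one_sub_div hG0]
    exact div_ne_zero (by rwa [← neg_ne_zero, neg_sub]) hG0
  -- Both sides solve `(1 - z c F') Y = z`.
  have hFH : F = z * H := mul_left_cancel₀ hG1 (by linear_combination hFx - z * hH)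
  -- Both sides solve `(1 - z c F') Y = z c F'`.
  have hHH' : c * (H' - 1) = H - 1 :=
    mul_left_cancel₀ hG1 (by linear_combination c * hH' - hH)
  have hH'eq : H' - 1 = 1 / c * (H - 1) := by rw [← hHH', one_div, inv_mul_cancel_left₀ hc]
  rw [hG]
  refine ⟨⟨hG0, hden, ?_⟩, ?_, trivial, hH'eq, ?_⟩
  · rw [eq_div_iff hden, one_sub_div hG0, mul_div_assoc', div_eq_iff hG0]
    linear_combination -hH
  · linear_combination hFH
  · linear_combination hFH + hH'eq
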